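/- Let $K\ge 1$ be an integer. For each $i=1,\dots,K$ let $b_{i0},b_{i1},b_{i2},\dots$ be non-negative real numbers with $b_{i0}>0$ and $b_{i1}>0$ such that the power series $B_i(\theta)=\sum_{k\ge 0} b_{ik}\theta^k/k!$ has radius of convergence $R_i\in(0,\infty]$. For $0<\theta<R_i$ let $\xi_i(\theta)$ be a random variable with $$P(\xi_i(\theta)=k)=\frac{b_{ik}\theta^k}{k!\,B_i(\theta)},\qquad k=0,1,2,\dots,$$ and let $m_i(\theta)=E\,\xi_i(\theta)$. Let $0<\alpha_i'<\alpha_i''$ be such that $m_i^{-1}(\alpha_i'')$ exists and is less than $R_i$, that is, $m_i(\theta)=\alpha_i''$ for some $\theta\in(0,R_i)$, for $1\le i\le K$. The sector is the set of all pairs $(\mathbf n,N)$ with $\mathbf n=(n_1,\dots,n_K)$, where $n_1,\dots,n_K,N$ are non-negative integers, $N\ge1$, and $\alpha_i'<n_i/N<\alpha_i''$ for $1\le i\le K$. Let $\eta_{ij}=\eta_{ij}^{(\mathbf n,N)}$ ($1\le i\le K$, $1\le j\le N$) be non-negative integer-valued random variables, for all $(\mathbf n,N)$ defined on one common probability space (with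 arbitrary dependence between different pairs $(\mathbf n,N)$). Assume that they obey the multi-colour generalized allocation scheme of placing $n_i$ balls of colour $i$ ($1\le i\le K$) into $N$ boxes: for every $(\mathbf n,N)$ in the sector there are parameters $\theta_i=\theta_i(\mathbf n,N)\in(0,R_i)$ such that, with independent copies $\xi_{i1},\dots,\xi_{iN}$ of $\xi_i(\theta_i)$, and provided that $P(\xi_{i1}+\dots+\xi_{iN}=n_i)>0$ for all $i$, $$P\big(\eta_{ij}=k_{ij}\text{ for all }i,j\big)=\prod_{i=1}^K P\big(\xi_{i1}=k_{i1},\dots,\xi_{iN}=k_{iN}\,\big|\,\xi_{i1}+\dots+\xi_{iN}=n_i\big)$$ for all non-negative integers $k_{ij}$ with $k_{i1}+\dots+k_{iN}=n_i$, $1\le i\le K$. Let $\mathbf s=(s_1,\dots,s_K)$ be a fixed vector of non-negative integers with $b_{is_i}>0$ for $1\le i\le K$, and let $$\mu_{\mathbf s\mathbf nN}=\sum_{j=1}^N\prod_{i=1}^K \mathbb I_{\{\eta_{ij}=s_i\}}$$ be the number of boxes containing exactly $s_i$ balls of colour $i$ for every $i$. Let $(d_N)$ be a sequence of real numbers, non-zero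 for all large $N$, with $$\lim_{N\to\infty}\frac{\sqrt{N\ln N}}{d_N}=0.$$ Then, almost surely, $$\frac{\mu_{\mathbf s\mathbf nN}-E\,\mu_{\mathbf s\mathbf nN}}{d_N}\longrightarrow 0$$ as $n_1,\dots,n_K,N\to\infty$ with $(\mathbf n,N)$ in the sector. -/

import Mathlib

open MeasureTheory ProbabilityTheory Filter Topology

noncomputable section

namespace MultiColour

/-- The radius of convergence `R ∈ [0, ∞]` of the power series `∑ b k * θ ^ k / k!`. -/
def convRadius (b : ℕ → ℝ) : ENNReal :=
  (FormalMultilinearSeries.ofScalars ℝ (fun k : ℕ => b k / (k.factorial : ℝ))).radius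

/-- `B(θ) = ∑ b k * θ ^ k / k!`. -/
def genFun (b : ℕ → ℝ) (θ : ℝ) : ℝ :=
  ∑' k : ℕ, b k * θ ^ k / (k.factorial : ℝ)

/-- The power series distribution: the law on `ℕ` of the random variable `ξ(θ)` with
`P(ξ(θ) = k) = b k * θ ^ k / (k! * B(θ))`. It is used for `b ≥ 0`, `b 0 > 0` and `0 < θ < R`. -/
def xiLaw (b : ℕ → ℝ) (θ : ℝ) : Measure ℕ :=
  Measure.sum fun k : ℕ =>
    ENNReal.ofReal (b k * θ ^ k / ((k.factorial : ℝ) * genFun b θ)) • Measure.dirac k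

/-- The mean `m(θ) = E ξ(θ)`. -/
def mean (b : ℕ → ℝ) (θ : ℝ) : ℝ :=
  ∫ k : ℕ, (k : ℝ) ∂(xiLaw b θ)

/-- The joint law of `N` independent copies `ξ_1(θ), …, ξ_N(θ)` of `ξ(θ)`. -/
def xiVecLaw (b : ℕ → ℝ) (θ : ℝ) (N : ℕ) : Measure (Fin N → ℕ) :=
  Measure.pi fun _ : Fin N => xiLaw b θ

/-- The event `ξ_1 + ⋯ + ξ_N = m`. -/
def sumEvent (N m : ℕ) : Set (Fin N → ℕ) :=
  {x | ∑ j, x j = m}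

/-- The contents `η i j` (number of balls of colour `i` in box `j`) obey the multi-colour
generalized allocation scheme of placing `n i` balls of colour `i`, for all `i`, into `N` boxes:
`P(η = k) = ∏ i, P(ξ_{i1} = k_{i1}, …, ξ_{iN} = k_{iN} | ξ_{i1} + ⋯ + ξ_{iN} = n i)`
for all arrays `k` of natural numbers with `k_{i1} + ⋯ + k_{iN} = n i` for all `i`, where
`ξ_{i1}, …, ξ_{iN}` are independent copies of `ξ_i(θ i)`. -/
def ObeysScheme {Ω : Type*} [MeasurableSpace Ω] (P : Measure Ω) {K : ℕ}
    (b : Fin K → ℕ → ℝ) (θ : Fin K → ℝ) (n : Fin K → ℕ) (N : ℕ)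
    (η : Fin K → Fin N → Ω → ℕ) : Prop :=
  ∀ k : Fin K → Fin N → ℕ, (∀ i, ∑ j, k i j = n i) →
    P {ω | ∀ i j, η i j ω = k i j} =
      ∏ i, cond (xiVecLaw (b i) (θ i) N) (sumEvent N (n i)) {k i}

/-- The number of boxes that contain exactly `s i` balls of colour `i` for every `i`. -/
def boxCount {Ω : Type*} {K N : ℕ} (η : Fin K → Fin N → Ω → ℕ) (s : Fin K → ℕ) (ω : Ω) : ℝ :=
  ∑ j : Fin N, ∏ i : Fin K, if η i j ω = s i then (1 : ℝ) else 0

/-- The sector of all pairs `(n, N)` with `α' i < n i / N < α'' i` for every `i`. As `α' i > 0`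
in all uses, `N = 0` does not occur in it. -/
def sector {K : ℕ} (α' α'' : Fin K → ℝ) : Set ((Fin K → ℕ) × ℕ) :=
  {x | ∀ i, α' i < (x.1 i : ℝ) / (x.2 : ℝ) ∧ (x.1 i : ℝ) / (x.2 : ℝ) < α'' i}

/-- The filter `n₁, …, n_K, N → ∞` with `(n, N)` in the sector. -/
def sectorAtTop {K : ℕ} (α' α'' : Fin K → ℝ) : Filter ((Fin K → ℕ) × ℕ) :=
  atTop ⊓ 𝓟 (sector α' α'')

end MultiColour

end

/-! The factor θ^n / B(θ)^N in the weight of a configuration depends only on its sum n, so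
conditioning on the sum erases the parameter (`cond_xiVecLaw_eq`). The given parameter of colour i
may therefore be replaced by one whose mean is exactly n_i / N. In the sector such a parameter
exists by continuity of the mean and stays in a fixed compact subinterval of (0, R_i), which makes
the estimates uniform.

For this parameter the sum equals n_i with probability at least N^(-3) once N is large. Conditioning
then costs at most a factor N^3 per colour: the law of the allocation is at most N^(3K) times a law
under which the boxes are independent and identically distributed. Hoeffding's inequality with r =
√((2K+1) N log N) bounds the tail of the count around its mean N p in the independent model by 2
N^(3K) N^(-(4K+2)) = 2 N^(-(K+2)) (`eventually_measureReal_boxCount_le`). At level N the sector has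
O(N^K) vectors, so Borel–Cantelli applies whatever the dependence between pairs
(`ae_eventually_abs_boxCount_sub_lt`). The same tail bound puts the expectation within 2r of N p, so
the centred count is eventually at most 3r = o(d_N).

The polynomial lower bound (`eventually_le_sumProb`) needs no local limit theorem. Chebyshev's
inequality gives some value at distance O(√N) from n_i with probability at least 1/N. Exchanging a
coordinate 0 for a 1 links the events "sum u" and "sum u + 1" (`occSum_swap`). As the numbers of
zeros and ones concentrate, neighbouring point probabilities differ by a relative error O(√(log N /
N)), up to a negligible additive term. Over O(√N) steps the loss is a factor exp(-O(√(log N))),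
which is at least 1/N. -/

noncomputable section

namespace MultiColour

/-! ### Power series distributions -/

/-- The `k`-th term `b k * θ ^ k / k!` of the generating function. -/
def term (b : ℕ → ℝ) (θ : ℝ) (k : ℕ) : ℝ := b k * θ ^ k / (k.factorial : ℝ)

/-- The probability `P(ξ(θ) = k)`. -/
def prob (b : ℕ → ℝ) (θ : ℝ) (k : ℕ) : ℝ := term b θ k / genFun b θ

/-- A coefficient sequence as in the allocation scheme, together with a parameter `t` at which the
generating function has an absolutely convergent second derivative. -/
structure Regular (b : ℕ → ℝ) (t : ℝ) : Prop where
  nonneg : ∀ k, 0 ≤ b k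
  zero_pos : 0 < b 0
  one_pos : 0 < b 1
  pos : 0 < t
  summable : Summable fun k : ℕ => ((k : ℝ) + 1) ^ 2 * term b t k

/-- Strictly inside the disc of convergence the terms are dominated by C a^k with a < 1, which
absorbs any polynomial factor. -/
lemma summable_sq_mul_term {b : ℕ → ℝ} (hb : ∀ k, 0 ≤ b k) {t : ℝ} (ht : 0 ≤ t)
    (htR : ENNReal.ofReal t < convRadius b) :
    Summable fun k : ℕ => ((k : ℝ) + 1) ^ 2 * term b t k := by
  obtain ⟨a, ha, C, hC, h⟩ :=
    FormalMultilinearSeries.norm_mul_pow_le_mul_pow_of_lt_radius (r := t.toNNReal) _ htR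
  have hterm : ∀ k, term b t k ≤ C * a ^ k := by
    intro k
    have := h k
    rw [FormalMultilinearSeries.ofScalars_norm, Real.coe_toNNReal t ht, Real.norm_of_nonneg
      (div_nonneg (hb k) (by positivity))] at this
    refine le_trans (le_of_eq ?_) this
    rw [term]; ring
  have ha' : ‖a‖ < 1 := by rw [Real.norm_of_nonneg ha.1.le]; exact ha.2
  have h2 := summable_pow_mul_geometric_of_norm_lt_one 2 ha'
  have h1 := summable_pow_mul_geometric_of_norm_lt_one 1 ha'
  have h0 := summable_pow_mul_geometric_of_norm_lt_one 0 ha'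
  have hs : Summable fun k : ℕ => ((k : ℝ) + 1) ^ 2 * (C * a ^ k) := by
    refine (((h2.add (h1.mul_left 2)).add h0).mul_left C).congr fun k => ?_
    ring
  refine Summable.of_nonneg_of_le (fun k => ?_) (fun k => ?_) hs
  · exact mul_nonneg (by positivity)
      (div_nonneg (mul_nonneg (hb k) (pow_nonneg ht k)) (by positivity))
  · exact mul_le_mul_of_nonneg_left (hterm k) (by positivity)

namespace Regular

variable {b : ℕ → ℝ} {t θ : ℝ}

lemma term_nonneg (h : Regular b t) (h0 : 0 ≤ θ) (k : ℕ) : 0 ≤ term b θ k :=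
  div_nonneg (mul_nonneg (h.nonneg k) (pow_nonneg h0 k)) (by positivity)

lemma term_le (h : Regular b t) (h0 : 0 ≤ θ) (h1 : θ ≤ t) (k : ℕ) : term b θ k ≤ term b t k := by
  have := h.nonneg k
  unfold term
  gcongr

lemma norm_mul_term_le (h : Regular b t) (h0 : 0 ≤ θ) (h1 : θ ≤ t) {f : ℕ → ℝ}
    (hf : ∀ k, |f k| ≤ ((k : ℝ) + 1) ^ 2) (k : ℕ) :
    ‖f k * term b θ k‖ ≤ ((k : ℝ) + 1) ^ 2 * term b t k := by
  rw [norm_mul, Real.norm_of_nonneg (h.term_nonneg h0 k), Real.norm_eq_abs]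
  exact mul_le_mul (hf k) (h.term_le h0 h1 k) (h.term_nonneg h0 k) (by positivity)

lemma summable_mul_term (h : Regular b t) (h0 : 0 ≤ θ) (h1 : θ ≤ t) {f : ℕ → ℝ}
    (hf : ∀ k, |f k| ≤ ((k : ℝ) + 1) ^ 2) : Summable fun k => f k * term b θ k :=
  Summable.of_norm_bounded h.summable (h.norm_mul_term_le h0 h1 hf)

lemma summable_term (h : Regular b t) (h0 : 0 ≤ θ) (h1 : θ ≤ t) : Summable (term b θ) := by
  simpa using h.summable_mul_term h0 h1 (f := fun _ => 1) fun k => by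
    rw [abs_one]; nlinarith [(Nat.cast_nonneg k : (0 : ℝ) ≤ k)]

lemma summable_id_mul_term (h : Regular b t) (h0 : 0 ≤ θ) (h1 : θ ≤ t) :
    Summable fun k : ℕ => (k : ℝ) * term b θ k :=
  h.summable_mul_term h0 h1 fun k => by
    rw [Nat.abs_cast]; nlinarith [(Nat.cast_nonneg k : (0 : ℝ) ≤ k)]

lemma summable_id_sq_mul_term (h : Regular b t) (h0 : 0 ≤ θ) (h1 : θ ≤ t) :
    Summable fun k : ℕ => (k : ℝ) ^ 2 * term b θ k :=
  h.summable_mul_term h0 h1 fun k => by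
    rw [abs_of_nonneg (by positivity)]; nlinarith [(Nat.cast_nonneg k : (0 : ℝ) ≤ k)]

lemma le_genFun (h : Regular b t) (h0 : 0 ≤ θ) (h1 : θ ≤ t) : b 0 ≤ genFun b θ := by
  have := (h.summable_term h0 h1).le_tsum 0 fun k _ => h.term_nonneg h0 k
  simpa [term, genFun] using this

lemma genFun_pos (h : Regular b t) (h0 : 0 ≤ θ) (h1 : θ ≤ t) : 0 < genFun b θ :=
  h.zero_pos.trans_le (h.le_genFun h0 h1)

lemma genFun_le (h : Regular b t) (h0 : 0 ≤ θ) (h1 : θ ≤ t) : genFun b θ ≤ genFun b t :=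
  (h.summable_term h0 h1).tsum_le_tsum (h.term_le h0 h1) (h.summable_term h.pos.le le_rfl)

lemma prob_nonneg (h : Regular b t) (h0 : 0 ≤ θ) (h1 : θ ≤ t) (k : ℕ) : 0 ≤ prob b θ k :=
  div_nonneg (h.term_nonneg h0 k) (h.genFun_pos h0 h1).le

lemma hasSum_prob (h : Regular b t) (h0 : 0 ≤ θ) (h1 : θ ≤ t) : HasSum (prob b θ) 1 := by
  have := (h.summable_term h0 h1).hasSum.div_const (genFun b θ)
  rwa [show (∑' k, term b θ k) = genFun b θ from rfl, div_self (h.genFun_pos h0 h1).ne'] at this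

end Regular

lemma xiLaw_eq_sum (b : ℕ → ℝ) (θ : ℝ) :
    xiLaw b θ = Measure.sum fun k : ℕ => ENNReal.ofReal (prob b θ k) • Measure.dirac k := by
  simp only [xiLaw, prob, term, div_div]

lemma xiLaw_singleton (b : ℕ → ℝ) (θ : ℝ) (k : ℕ) :
    xiLaw b θ {k} = ENNReal.ofReal (prob b θ k) := by
  rw [xiLaw_eq_sum, Measure.sum_smul_dirac_singleton]

namespace Regular

variable {b : ℕ → ℝ} {t θ : ℝ}

lemma isProbabilityMeasure (h : Regular b t) (h0 : 0 ≤ θ) (h1 : θ ≤ t) :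
    IsProbabilityMeasure (xiLaw b θ) := by
  constructor
  rw [xiLaw_eq_sum, Measure.sum_apply _ MeasurableSet.univ]
  simp only [Measure.smul_apply, measure_univ, smul_eq_mul, mul_one]
  rw [← ENNReal.ofReal_tsum_of_nonneg (h.prob_nonneg h0 h1) (h.hasSum_prob h0 h1).summable,
    (h.hasSum_prob h0 h1).tsum_eq, ENNReal.ofReal_one]

lemma integrable (h : Regular b t) (h0 : 0 ≤ θ) (h1 : θ ≤ t) {f : ℕ → ℝ}
    (hf : ∀ k, |f k| ≤ ((k : ℝ) + 1) ^ 2) : Integrable f (xiLaw b θ) := by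
  rw [xiLaw_eq_sum]
  refine integrable_sum_dirac (fun _ => ENNReal.ofReal_ne_top) ?_
  refine ((h.summable_mul_term h0 h1 hf).norm.mul_left (genFun b θ)⁻¹).congr fun k => ?_
  rw [ENNReal.toReal_ofReal (h.prob_nonneg h0 h1 k), norm_mul,
    Real.norm_of_nonneg (h.term_nonneg h0 k), prob]
  ring

lemma integral_eq (h : Regular b t) (h0 : 0 ≤ θ) (h1 : θ ≤ t) (f : ℕ → ℝ) :
    ∫ k, f k ∂(xiLaw b θ) = (∑' k, f k * term b θ k) / genFun b θ := by
  rw [xiLaw_eq_sum, integral_sum_dirac fun _ => ENNReal.ofReal_ne_top, ← tsum_div_const]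
  refine tsum_congr fun k => ?_
  rw [ENNReal.toReal_ofReal (h.prob_nonneg h0 h1 k), smul_eq_mul, prob]
  ring

lemma mean_eq (h : Regular b t) (h0 : 0 ≤ θ) (h1 : θ ≤ t) :
    mean b θ = (∑' k : ℕ, (k : ℝ) * term b θ k) / genFun b θ :=
  h.integral_eq h0 h1 fun k => (k : ℝ)

/-- Weierstrass M-test: the terms at `t` majorise those on the whole closed interval, so continuity
includes both endpoints. -/
lemma continuousOn_tsum_mul_term (h : Regular b t) {f : ℕ → ℝ}
    (hf : ∀ k, |f k| ≤ ((k : ℝ) + 1) ^ 2) :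
    ContinuousOn (fun θ => ∑' k, f k * term b θ k) (Set.Icc 0 t) := by
  refine continuousOn_tsum (fun k => ?_) h.summable fun k θ hθ =>
    h.norm_mul_term_le hθ.1 hθ.2 hf k
  unfold term
  fun_prop

lemma continuousOn_mean (h : Regular b t) : ContinuousOn (mean b) (Set.Icc 0 t) := by
  have h1 : ContinuousOn (fun θ => ∑' k : ℕ, (k : ℝ) * term b θ k) (Set.Icc 0 t) :=
    h.continuousOn_tsum_mul_term fun k => by
      rw [Nat.abs_cast]; nlinarith [(Nat.cast_nonneg k : (0 : ℝ) ≤ k)]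
  have h2 : ContinuousOn (genFun b) (Set.Icc 0 t) := by
    have := h.continuousOn_tsum_mul_term (f := fun _ => 1) fun k => by
      rw [abs_one]; nlinarith [(Nat.cast_nonneg k : (0 : ℝ) ≤ k)]
    simp only [one_mul] at this
    exact this
  exact (h1.div h2 fun θ hθ => (h.genFun_pos hθ.1 hθ.2).ne').congr
    fun θ hθ => h.mean_eq hθ.1 hθ.2

lemma mean_zero (h : Regular b t) : mean b 0 = 0 := by
  rw [h.mean_eq le_rfl h.pos.le]
  have : ∀ k : ℕ, (k : ℝ) * term b 0 k = 0 := by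
    intro k
    rcases k with _ | k <;> simp [term]
  simp [this]

/-- Every value in `(0, m(t))` is attained by the mean on `(0, t)`. -/
lemma exists_mean_eq (h : Regular b t) {x : ℝ} (hx0 : 0 < x) (hx : x < mean b t) :
    ∃ θ, 0 < θ ∧ θ ≤ t ∧ mean b θ = x := by
  -- Uniqueness of the parameter is never needed, so the intermediate value theorem replaces
  -- monotonicity of the mean.
  have := intermediate_value_Icc h.pos.le h.continuousOn_mean
  obtain ⟨θ, hθ, rfl⟩ := this ⟨by rw [h.mean_zero]; exact hx0.le, hx.le⟩
  refine ⟨θ, lt_of_le_of_ne hθ.1 ?_, hθ.2, rfl⟩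
  rintro rfl
  exact hx0.ne' h.mean_zero

/-- The mean grows at most linearly. -/
lemma mean_le (h : Regular b t) (h0 : 0 ≤ θ) (h1 : θ ≤ t) :
    mean b θ ≤ θ * ((∑' k : ℕ, (k : ℝ) * term b t k) / (t * b 0)) := by
  have ht := h.pos
  -- For k ≥ 1 one factor θ/t is split off and the other k - 1 powers are compared; the term k = 0
  -- vanishes.
  have key : ∀ k : ℕ, (k : ℝ) * term b θ k ≤ θ / t * ((k : ℝ) * term b t k) := by
    intro k
    rcases k with _ | k
    · simp
    · have hb := h.nonneg (k + 1)
      have : θ ^ k ≤ t ^ k := by gcongr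
      have e : θ / t * (((k + 1 : ℕ) : ℝ) * term b t (k + 1)) =
          ((k + 1 : ℕ) : ℝ) * (b (k + 1) * (t ^ k * θ) / ((k + 1).factorial : ℝ)) := by
        unfold term; rw [pow_succ]; field_simp
      rw [e]
      unfold term
      rw [pow_succ]
      gcongr
  have hs := h.summable_id_mul_term ht.le le_rfl
  have hle := (h.summable_id_mul_term h0 h1).tsum_le_tsum key (hs.mul_left _)
  rw [tsum_mul_left] at hle
  have hnn : 0 ≤ ∑' k : ℕ, (k : ℝ) * term b θ k :=
    tsum_nonneg fun k => mul_nonneg (Nat.cast_nonneg k) (h.term_nonneg h0 k)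
  rw [h.mean_eq h0 h1]
  calc _ ≤ (∑' k : ℕ, (k : ℝ) * term b θ k) / b 0 :=
        div_le_div_of_nonneg_left hnn h.zero_pos (h.le_genFun h0 h1)
    _ ≤ (θ / t * ∑' k : ℕ, (k : ℝ) * term b t k) / b 0 := by
        have := h.zero_pos
        gcongr
    _ = _ := by have := h.zero_pos; field_simp

/-- The parameter is bounded below where the mean is. -/
lemma exists_le_of_le_mean (h : Regular b t) {a : ℝ} (ha : 0 < a) :
    ∃ c > 0, ∀ θ, 0 ≤ θ → θ ≤ t → a ≤ mean b θ → c ≤ θ := by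
  set D := (∑' k : ℕ, (k : ℝ) * term b t k) / (t * b 0) with hD
  have hD0 : 0 ≤ D := div_nonneg
    (tsum_nonneg fun k => mul_nonneg (Nat.cast_nonneg k) (h.term_nonneg h.pos.le k))
    (mul_nonneg h.pos.le h.zero_pos.le)
  refine ⟨a / (D + 1), by positivity, fun θ h0 h1 hm => ?_⟩
  rw [div_le_iff₀ (by positivity)]
  have := h.mean_le h0 h1
  rw [← hD] at this
  nlinarith

/-- A bound, uniform in the parameter, for the second moment. -/
lemma exists_integral_sq_le (h : Regular b t) :
    ∃ V > 0, ∀ θ, 0 ≤ θ → θ ≤ t → ∫ k : ℕ, (k : ℝ) ^ 2 ∂(xiLaw b θ) ≤ V := by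
  have hs := h.summable_id_sq_mul_term h.pos.le le_rfl
  have hn : 0 ≤ ∑' k : ℕ, (k : ℝ) ^ 2 * term b t k :=
    tsum_nonneg fun k => mul_nonneg (by positivity) (h.term_nonneg h.pos.le k)
  have hb := h.zero_pos
  refine ⟨(∑' k : ℕ, (k : ℝ) ^ 2 * term b t k) / b 0 + 1, by positivity, fun θ h0 h1 => ?_⟩
  rw [h.integral_eq h0 h1 fun k => (k : ℝ) ^ 2]
  refine le_trans ?_ (le_add_of_nonneg_right zero_le_one)
  refine div_le_div₀ hn ?_ hb (h.le_genFun h0 h1)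
  exact (h.summable_id_sq_mul_term h0 h1).tsum_le_tsum
    (fun k => mul_le_mul_of_nonneg_left (h.term_le h0 h1 k) (by positivity)) hs

/-- The probabilities of `0` and `1` are bounded below where the parameter is. -/
lemma exists_le_prob (h : Regular b t) {a : ℝ} (ha : 0 < a) :
    ∃ c > 0, ∀ θ, a ≤ θ → θ ≤ t → c ≤ prob b θ 0 ∧ c ≤ prob b θ 1 := by
  have hB := h.genFun_pos h.pos.le le_rfl
  have hb0 := h.zero_pos
  have hb1 := h.one_pos
  refine ⟨min (b 0 / genFun b t) (b 1 * a / genFun b t),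
    lt_min (by positivity) (by positivity), fun θ h0 h1 => ⟨?_, ?_⟩⟩
  · refine (min_le_left _ _).trans ?_
    simp only [prob, term, pow_zero, mul_one, Nat.factorial_zero, Nat.cast_one, div_one]
    exact div_le_div_of_nonneg_left hb0.le (h.genFun_pos (ha.le.trans h0) h1)
      (h.genFun_le (ha.le.trans h0) h1)
  · refine (min_le_right _ _).trans ?_
    simp only [prob, term, pow_one, Nat.factorial_one, Nat.cast_one, div_one]
    have := ha.le.trans h0
    exact div_le_div₀ (by positivity) (by gcongr) (h.genFun_pos (ha.le.trans h0) h1)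
      (h.genFun_le (ha.le.trans h0) h1)

end Regular

/-! ### Concentration for product measures -/

/-- Two-sided Hoeffding inequality for a sum of bounded functions of independent, identically
distributed coordinates. -/
lemma measureReal_abs_sum_sub_ge_le {X : Type*} [MeasurableSpace X] (ρ : Measure X)
    [IsProbabilityMeasure ρ] {f : X → ℝ} (hf : Measurable f) (hf01 : ∀ x, f x ∈ Set.Icc (0 : ℝ) 1)
    (N : ℕ) {r : ℝ} (hr : 0 ≤ r) :
    (Measure.pi fun _ : Fin N => ρ).real {x | r ≤ |∑ j, f (x j) - N * ∫ y, f y ∂ρ|} ≤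
      2 * Real.exp (-2 * r ^ 2 / N) := by
  set Q := Measure.pi fun _ : Fin N => ρ
  set m := ∫ y, f y ∂ρ
  -- Hoeffding's lemma: the variance proxy is 1/4 for values in [0, 1], hence N/4 for the sum, which
  -- gives the exponent -2r²/N.
  have hsub : HasSubgaussianMGF (fun y => f y - m) ((‖(1 : ℝ) - 0‖₊ / 2) ^ 2) ρ :=
    hasSubgaussianMGF_of_mem_Icc hf.aemeasurable (Eventually.of_forall hf01)
  have hc : ∀ g : X → ℝ, Measurable g → HasSubgaussianMGF g ((‖(1 : ℝ) - 0‖₊ / 2) ^ 2) ρ →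
      Q.real {x | r ≤ ∑ j, g (x j)} ≤ Real.exp (-2 * r ^ 2 / N) := by
    intro g hg hgs
    have hind : iIndepFun (fun (j : Fin N) (x : Fin N → X) => g (x j)) Q :=
      iIndepFun_pi (X := fun _ => g) fun _ => hg.aemeasurable
    have := HasSubgaussianMGF.measure_sum_ge_le_of_iIndepFun hind (s := Finset.univ)
      (c := fun _ => (‖(1 : ℝ) - 0‖₊ / 2) ^ 2) (fun j _ => ?_) hr
    · refine this.trans (le_of_eq ?_)
      congr 1
      simp
      rcases Nat.eq_zero_or_pos N with rfl | hN
      · simp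
      · field_simp
    · have hmap : Q.map (fun x => x j) = ρ := (measurePreserving_eval (fun _ : Fin N => ρ) j).map_eq
      refine HasSubgaussianMGF.of_map (X := g) (measurable_pi_apply j).aemeasurable ?_
      rwa [hmap]
  have h1 := hc (fun y => f y - m) (hf.sub_const m) hsub
  have h2 := hc (fun y => -(f y - m)) (hf.sub_const m).neg hsub.neg
  have hset : {x : Fin N → X | r ≤ |∑ j, f (x j) - N * m|} ⊆
      {x | r ≤ ∑ j, (f (x j) - m)} ∪ {x | r ≤ ∑ j, -(f (x j) - m)} := by
    intro x hx
    simp only [Set.mem_ofPred_eq, Set.mem_union, Finset.sum_sub_distrib, Finset.sum_const,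
      Finset.card_univ, Fintype.card_fin, nsmul_eq_mul, Finset.sum_neg_distrib] at hx ⊢
    exact le_abs.1 hx
  calc _ ≤ Q.real ({x | r ≤ ∑ j, (f (x j) - m)} ∪ {x | r ≤ ∑ j, -(f (x j) - m)}) :=
        measureReal_mono hset
    _ ≤ _ := (measureReal_union_le _ _).trans (by linarith)

/-- Chebyshev's inequality for a sum of independent, identically distributed coordinates. -/
lemma measure_abs_sum_sub_ge_le {X : Type*} [MeasurableSpace X] (ρ : Measure X)
    [IsProbabilityMeasure ρ] {f : X → ℝ} (hf : MemLp f 2 ρ) (N : ℕ) {r : ℝ} (hr : 0 < r) :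
    (Measure.pi fun _ : Fin N => ρ) {x | r ≤ |∑ j, f (x j) - N * ∫ y, f y ∂ρ|} ≤
      ENNReal.ofReal (N * variance f ρ / r ^ 2) := by
  set Q := Measure.pi fun _ : Fin N => ρ
  have hL : ∀ j : Fin N, MemLp (fun x : Fin N → X => f (x j)) 2 Q := fun j =>
    hf.comp_measurePreserving (measurePreserving_eval (fun _ : Fin N => ρ) j)
  have hvar := variance_sum_pi (μ := fun _ : Fin N => ρ) (X := fun _ => f) fun _ => hf
  have hint : ∀ j : Fin N, ∫ x, f (x j) ∂Q = ∫ y, f y ∂ρ := fun j => by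
    have hmp := measurePreserving_eval (fun _ : Fin N => ρ) j
    have := integral_map (μ := Q) hmp.measurable.aemeasurable (f := f)
      (by rw [hmp.map_eq]; exact hf.1)
    rw [hmp.map_eq] at this
    exact this.symm
  have hch := meas_ge_le_variance_div_sq (μ := Q) (X := ∑ j : Fin N, fun x : Fin N → X => f (x j))
    (memLp_finsetSum' _ fun j _ => hL j) hr
  rw [hvar] at hch
  simp only [Finset.sum_apply] at hch
  rw [integral_finsetSum _ fun j _ => (hL j).integrable one_le_two] at hch
  simpa [hint] using hch

/-! ### A lower bound for the point probabilities of sums -/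

lemma sumEvent_eq (N u : ℕ) :
    sumEvent N u = ↑(Finset.piAntidiag (Finset.univ : Finset (Fin N)) u) := by
  ext x
  simp [sumEvent]

/-- The number of coordinates equal to `a`. -/
def occurrences {N : ℕ} (a : ℕ) (x : Fin N → ℕ) : ℝ := ∑ j, if x j = a then (1 : ℝ) else 0

section

variable (ρ : Measure ℕ)

/-- The probability that `N` independent variables with law `ρ` sum up to `u`. -/
def sumProb (N u : ℕ) : ℝ := (Measure.pi fun _ : Fin N => ρ).real (sumEvent N u)

lemma sumProb_nonneg (N u : ℕ) : 0 ≤ sumProb ρ N u := measureReal_nonneg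

/-- The expectation of `occurrences a` on the event that the sum is `u`. -/
def occSum (N u a : ℕ) : ℝ :=
  ∑ x ∈ Finset.piAntidiag Finset.univ u, (∏ j : Fin N, ρ.real {x j}) * occurrences a x

/-- Exchanging a coordinate `0` for a coordinate `1`. -/
lemma occSum_swap (N u : ℕ) :
    occSum ρ N u 0 * ρ.real {1} = occSum ρ N (u + 1) 1 * ρ.real {0} := by
  have expand : ∀ v a, occSum ρ N v a = ∑ j, ∑ x ∈ (Finset.piAntidiag Finset.univ v).filter
      (fun x : Fin N → ℕ => x j = a), ∏ j : Fin N, ρ.real {x j} := by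
    intro v a
    simp only [occSum, occurrences, Finset.mul_sum, mul_ite, mul_one, mul_zero, Finset.sum_filter]
    exact Finset.sum_comm
  rw [expand, expand, Finset.sum_mul, Finset.sum_mul]
  refine Finset.sum_congr rfl fun j _ => ?_
  rw [Finset.sum_mul, Finset.sum_mul]
  have hsum : ∀ (x : Fin N → ℕ) (a : ℕ), ∑ i, Function.update x j a i =
      a + ∑ i ∈ Finset.univ \ {j}, x i := fun x a => Finset.sum_update_of_mem (Finset.mem_univ j) x a
  have hsum' : ∀ x : Fin N → ℕ, ∑ i, x i = x j + ∑ i ∈ Finset.univ \ {j}, x i := fun x => by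
    simpa using hsum x (x j)
  -- With position `j` fixed, overwriting 0 by 1 there is a bijection that raises the sum by one and
  -- changes only the factor at `j` in the weight.
  refine Finset.sum_nbij' (fun x => Function.update x j 1) (fun x => Function.update x j 0)
    ?_ ?_ ?_ ?_ ?_
  · intro x hx
    simp only [Finset.mem_filter, Finset.mem_piAntidiag, Finset.mem_univ, implies_true, and_true,
      Function.update_self] at hx ⊢
    have h1 : Finset.univ.sum (Function.update x j 1) = _ := hsum x 1
    have h2 : Finset.univ.sum x = _ := hsum' x
    omega
  · intro x hx
    simp only [Finset.mem_filter, Finset.mem_piAntidiag, Finset.mem_univ, implies_true, and_true,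
      Function.update_self] at hx ⊢
    have h1 : Finset.univ.sum (Function.update x j 0) = _ := hsum x 0
    have h2 : Finset.univ.sum x = _ := hsum' x
    omega
  · intro x hx
    have : x j = 0 := (Finset.mem_filter.1 hx).2
    simp [← this]
  · intro x hx
    have : x j = 1 := (Finset.mem_filter.1 hx).2
    simp [← this]
  · intro x hx
    have hxj : x j = 0 := (Finset.mem_filter.1 hx).2
    rw [← Finset.mul_prod_erase Finset.univ (fun i => ρ.real {x i}) (Finset.mem_univ j),
      ← Finset.mul_prod_erase Finset.univ (fun i => ρ.real {Function.update x j 1 i})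
        (Finset.mem_univ j), hxj, Function.update_self]
    have : ∏ i ∈ Finset.univ.erase j, ρ.real {Function.update x j 1 i} =
        ∏ i ∈ Finset.univ.erase j, ρ.real {x i} :=
      Finset.prod_congr rfl fun i hi => by rw [Function.update_of_ne (Finset.ne_of_mem_erase hi)]
    rw [this]
    ring

variable [IsProbabilityMeasure ρ]

lemma pi_real_singleton {N : ℕ} (x : Fin N → ℕ) :
    (Measure.pi fun _ : Fin N => ρ).real {x} = ∏ j, ρ.real {x j} := by
  simp [measureReal_def, ENNReal.toReal_prod]

lemma sumProb_eq_sum (N u : ℕ) :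
    sumProb ρ N u = ∑ x ∈ Finset.piAntidiag Finset.univ u, ∏ j : Fin N, ρ.real {x j} := by
  rw [sumProb, sumEvent_eq, ← sum_measureReal_singleton]
  exact Finset.sum_congr rfl fun x _ => pi_real_singleton ρ x

lemma occurrences_mem {N : ℕ} (a : ℕ) (x : Fin N → ℕ) : occurrences a x ∈ Set.Icc (0 : ℝ) N := by
  constructor
  · exact Finset.sum_nonneg fun j _ => by split_ifs <;> norm_num
  · calc occurrences a x ≤ ∑ _j : Fin N, (1 : ℝ) :=
        Finset.sum_le_sum fun j _ => by split_ifs <;> norm_num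
      _ = N := by simp

/-- The number of coordinates equal to `a` is close to its mean, also on the event that the sum
is `u`. -/
lemma abs_occSum_sub_le (N u a : ℕ) {r : ℝ} (hr : 0 ≤ r) :
    |occSum ρ N u a - N * ρ.real {a} * sumProb ρ N u| ≤
      r * sumProb ρ N u + N * (2 * Real.exp (-2 * r ^ 2 / N)) := by
  classical
  set Q := Measure.pi fun _ : Fin N => ρ
  set p := ρ.real {a}
  have hp : p ∈ Set.Icc (0 : ℝ) 1 := ⟨measureReal_nonneg, measureReal_le_one⟩
  set bad : Set (Fin N → ℕ) := {x | r ≤ |occurrences a x - N * p|}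
  have hbad : Q.real bad ≤ 2 * Real.exp (-2 * r ^ 2 / N) := by
    have := measureReal_abs_sum_sub_ge_le ρ (f := fun k => if k = a then (1 : ℝ) else 0)
      (measurable_from_top) (fun k => by split_ifs <;> simp) N hr
    have hi : ∫ k, (if k = a then (1 : ℝ) else 0) ∂ρ = p := by
      have := integral_indicator_one (μ := ρ) (measurableSet_singleton a)
      refine Eq.trans ?_ this
      refine integral_congr_ae (Eventually.of_forall fun k => ?_)
      simp [Set.indicator_apply]
    rw [hi] at this
    exact this
  set F := Finset.piAntidiag (Finset.univ : Finset (Fin N)) u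
  set w : (Fin N → ℕ) → ℝ := fun x => ∏ j, ρ.real {x j}
  have hw : ∀ x, 0 ≤ w x := fun x => Finset.prod_nonneg fun j _ => measureReal_nonneg
  -- Off the bad event the deviation is below `r`; on it, both quantities lie in [0, N].
  have hpt : ∀ x, |occurrences a x - N * p| ≤ r + N * (if x ∈ bad then (1 : ℝ) else 0) := by
    intro x
    split_ifs with hx
    · obtain ⟨h0, h1⟩ := occurrences_mem a x
      have hN : (0 : ℝ) ≤ N := Nat.cast_nonneg N
      have : (N : ℝ) * p ≤ N := mul_le_of_le_one_right hN hp.2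
      have : 0 ≤ (N : ℝ) * p := mul_nonneg hN hp.1
      rw [abs_le]
      constructor <;> linarith
    · have : ¬ r ≤ |occurrences a x - N * p| := hx
      linarith
  have hsb : ∑ x ∈ F, w x * (if x ∈ bad then (1 : ℝ) else 0) ≤ Q.real bad := by
    simp only [mul_ite, mul_one, mul_zero, ← Finset.sum_filter]
    calc ∑ x ∈ F with x ∈ bad, w x = ∑ x ∈ F with x ∈ bad, Q.real {x} :=
          Finset.sum_congr rfl fun x _ => (pi_real_singleton ρ x).symm
      _ = Q.real ↑(F.filter (· ∈ bad)) := sum_measureReal_singleton _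
      _ ≤ Q.real bad := measureReal_mono (fun x hx => by simpa using (Finset.mem_filter.1 hx).2)
  have hq : sumProb ρ N u = ∑ x ∈ F, w x := sumProb_eq_sum ρ N u
  calc |occSum ρ N u a - N * p * sumProb ρ N u|
      = |∑ x ∈ F, w x * (occurrences a x - N * p)| := by
        rw [hq, Finset.mul_sum, occSum, ← Finset.sum_sub_distrib]
        congr 1
        exact Finset.sum_congr rfl fun x _ => by ring
    _ ≤ ∑ x ∈ F, |w x * (occurrences a x - N * p)| := Finset.abs_sum_le_sum_abs _ _
    _ ≤ ∑ x ∈ F, (w x * r + N * (w x * (if x ∈ bad then (1 : ℝ) else 0))) := by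
        refine Finset.sum_le_sum fun x _ => ?_
        rw [abs_mul, abs_of_nonneg (hw x)]
        have := mul_le_mul_of_nonneg_left (hpt x) (hw x)
        linarith
    _ = r * sumProb ρ N u + N * ∑ x ∈ F, w x * (if x ∈ bad then (1 : ℝ) else 0) := by
        rw [Finset.sum_add_distrib, ← Finset.sum_mul, ← Finset.mul_sum, hq, mul_comm r]
    _ ≤ _ := by gcongr; exact hsb.trans hbad

/-- The point probabilities of the sum vary slowly. -/
lemma abs_sumProb_sub_succ_le {N : ℕ} (hN : 0 < N) (u : ℕ) {r c : ℝ} (hr : 0 ≤ r) (hc : 0 < c)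
    (h0 : c ≤ ρ.real {0}) (h1 : c ≤ ρ.real {1}) :
    |sumProb ρ N u - sumProb ρ N (u + 1)| ≤
      r / (c * N) * (sumProb ρ N u + sumProb ρ N (u + 1)) +
        4 * Real.exp (-2 * r ^ 2 / N) / c ^ 2 := by
  have hN' : (0 : ℝ) < N := by exact_mod_cast hN
  have e0 := abs_occSum_sub_le ρ N u 0 hr
  have e1 := abs_occSum_sub_le ρ N (u + 1) 1 hr
  have hs := occSum_swap ρ N u
  have q0 := sumProb_nonneg ρ N u
  have q1 := sumProb_nonneg ρ N (u + 1)
  have l0 : ρ.real {0} ≤ 1 := measureReal_le_one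
  have l1 : ρ.real {1} ≤ 1 := measureReal_le_one
  have hE := Real.exp_pos (-2 * r ^ 2 / N)
  generalize Real.exp (-2 * r ^ 2 / N) = E at *
  generalize sumProb ρ N u = x at *
  generalize sumProb ρ N (u + 1) = y at *
  generalize occSum ρ N u 0 = X at *
  generalize occSum ρ N (u + 1) 1 = Y at *
  generalize ρ.real {0} = a at *
  generalize ρ.real {1} = d at *
  have ha := hc.trans_le h0
  have hd := hc.trans_le h1
  -- The swap identity `X * d = Y * a` cancels the main terms, leaving only the two concentration
  -- errors.
  have key : N * (a * d) * |x - y| ≤ r * (d * x + a * y) + N * (4 * E) := by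
    have : N * (a * d) * |x - y| = |a * (Y - N * d * y) - d * (X - N * a * x)| := by
      rw [← abs_of_pos (show 0 < N * (a * d) by positivity), ← abs_mul]
      congr 1
      linear_combination hs
    rw [this]
    refine (abs_sub _ _).trans ?_
    rw [abs_mul, abs_mul, abs_of_pos ha, abs_of_pos hd]
    have b1 := mul_le_mul_of_nonneg_left e1 ha.le
    have b0 := mul_le_mul_of_nonneg_left e0 hd.le
    have hNE : 0 ≤ N * (2 * E) := by positivity
    nlinarith [mul_le_mul_of_nonneg_right l0 hNE, mul_le_mul_of_nonneg_right l1 hNE]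
  have h2 : |x - y| ≤ (r * (d * x + a * y) + N * (4 * E)) / (N * (a * d)) := by
    rw [le_div_iff₀ (by positivity), mul_comm]; exact key
  refine h2.trans ?_
  have split : (r * (d * x + a * y) + N * (4 * E)) / (N * (a * d)) =
      r / (a * N) * x + r / (d * N) * y + 4 * E / (a * d) := by
    field_simp
  rw [split]
  have : c ^ 2 ≤ a * d := by nlinarith
  have t1 : r / (a * N) ≤ r / (c * N) := by gcongr
  have t2 : r / (d * N) ≤ r / (c * N) := by gcongr
  have t3 : 4 * E / (a * d) ≤ 4 * E / c ^ 2 := by gcongr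
  nlinarith [mul_le_mul_of_nonneg_right t1 q0, mul_le_mul_of_nonneg_right t2 q1]

end

/-- A single step costs the factor (1 - e)/(1 + e) ≥ 1 - 2e and an error at most δ. The hypothesis
is symmetric, so steps can go either way; on iteration old errors are multiplied by factors at most
1 and merely add up. -/
lemma pow_mul_sub_le_of_slowly_varying {q : ℕ → ℝ} (hq : ∀ u, 0 ≤ q u) {e δ : ℝ} (he : 0 ≤ e)
    (he' : 2 * e ≤ 1) (hδ : 0 ≤ δ) (h : ∀ u, |q u - q (u + 1)| ≤ e * (q u + q (u + 1)) + δ)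
    (u m : ℕ) :
    (1 - 2 * e) ^ m * q u - m * δ ≤ q (u + m) ∧ (1 - 2 * e) ^ m * q (u + m) - m * δ ≤ q u := by
  have step : ∀ x y : ℝ, 0 ≤ x → 0 ≤ y → |x - y| ≤ e * (x + y) + δ →
      (1 - 2 * e) * x - δ ≤ y := by
    intro x y hx hy hxy
    have := (abs_le.1 hxy).2
    have h1 : (1 - e) * x - δ ≤ (1 + e) * y := by linarith
    by_contra hlt
    push Not at hlt
    have := mul_lt_mul_of_pos_left hlt (show 0 < 1 + e by linarith)
    nlinarith [mul_nonneg he hδ, mul_nonneg (mul_nonneg he he) hx]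
  have f1 : 0 ≤ 1 - 2 * e := by linarith
  have f2 : 1 - 2 * e ≤ 1 := by linarith
  induction m with
  | zero => simp
  | succ m ih =>
    have h1 := step _ _ (hq _) (hq _) (h (u + m))
    have h2 := step (q (u + m + 1)) (q (u + m)) (hq _) (hq _) (by
      rw [abs_sub_comm, add_comm (q (u + m + 1))]; exact h (u + m))
    rw [← add_assoc]
    push_cast
    constructor
    · have := mul_le_mul_of_nonneg_left ih.1 f1
      have : (1 - 2 * e) * (m * δ) ≤ m * δ := mul_le_of_le_one_left (by positivity) f2
      rw [pow_succ']
      linarith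
    · have hp : (1 - 2 * e) ^ m ≤ 1 := pow_le_one₀ f1 f2
      have hp0 : 0 ≤ (1 - 2 * e) ^ m := pow_nonneg f1 m
      have := mul_le_mul_of_nonneg_left h2 hp0
      have : (1 - 2 * e) ^ m * δ ≤ δ := mul_le_of_le_one_left hδ hp
      rw [pow_succ]
      linarith [ih.2]

/-- Some value within the order of the standard deviation from the mean is not too unlikely. -/
lemma exists_le_sumProb (ρ : Measure ℕ) [IsProbabilityMeasure ρ] {V : ℝ} (hV : 0 < V)
    (hL : MemLp (fun k : ℕ => (k : ℝ)) 2 ρ) (hρ : ∫ k : ℕ, (k : ℝ) ^ 2 ∂ρ ≤ V) {N n : ℕ}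
    (hN : 0 < N) (hn : (N : ℝ) * ∫ k : ℕ, (k : ℝ) ∂ρ = n) :
    ∃ v : ℕ, v ≤ n + ⌈√(2 * V * N)⌉₊ ∧ n ≤ v + ⌈√(2 * V * N)⌉₊ ∧
      1 ≤ sumProb ρ N v * (2 * (2 * ⌈√(2 * V * N)⌉₊ + 1)) := by
  have hN' : (0 : ℝ) < N := by exact_mod_cast hN
  -- Chosen so that Chebyshev's bound N V / R² equals 1/2.
  set R := √(2 * V * N) with hR
  have hR0 : 0 < R := Real.sqrt_pos.2 (by positivity)
  have hR2 : R ^ 2 = 2 * V * N := Real.sq_sqrt (by positivity)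
  set L := ⌈R⌉₊
  set Q := Measure.pi fun _ : Fin N => ρ
  have hch := measure_abs_sum_sub_ge_le ρ hL N hR0
  rw [hn] at hch
  have hvar : variance (fun k : ℕ => (k : ℝ)) ρ ≤ V := (variance_le_expectation_sq hL.1).trans hρ
  have hhalf : Q.real {x | R ≤ |∑ j, (x j : ℝ) - n|} ≤ 1 / 2 := by
    refine ENNReal.toReal_le_of_le_ofReal (by norm_num) (hch.trans (ENNReal.ofReal_le_ofReal ?_))
    rw [hR2, div_le_div_iff₀ (by positivity) (by norm_num)]
    nlinarith
  set I := Finset.Icc (n - L) (n + L)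
  have hcov : (Set.univ : Set (Fin N → ℕ)) ⊆
      {x | R ≤ |∑ j, (x j : ℝ) - n|} ∪ ⋃ v ∈ I, sumEvent N v := by
    intro x _
    by_cases hx : R ≤ |∑ j, (x j : ℝ) - n|
    · exact Or.inl hx
    · refine Or.inr ?_
      simp only [Set.mem_iUnion]
      refine ⟨∑ j, x j, ?_, rfl⟩
      push Not at hx
      have hRL : R ≤ L := Nat.le_ceil R
      obtain ⟨l1, l2⟩ := abs_lt.1 (hx.trans_le hRL)
      rw [← Nat.cast_sum] at l1 l2
      have l1' : ((n : ℕ) : ℝ) < ((∑ j, x j + L : ℕ) : ℝ) := by push_cast at *; linarith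
      have l2' : ((∑ j, x j : ℕ) : ℝ) < ((n + L : ℕ) : ℝ) := by push_cast at *; linarith
      have l1'' := Nat.cast_lt.1 l1'
      have l2'' := Nat.cast_lt.1 l2'
      rw [Finset.mem_Icc]
      omega
  have hge : 1 / 2 ≤ ∑ v ∈ I, sumProb ρ N v := by
    have h1 : (1 : ℝ) ≤ Q.real ({x | R ≤ |∑ j, (x j : ℝ) - n|} ∪ ⋃ v ∈ I, sumEvent N v) := by
      rw [← probReal_univ (μ := Q)]
      exact measureReal_mono hcov
    have h2 := h1.trans (measureReal_union_le _ _)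
    have h3 : Q.real (⋃ v ∈ I, sumEvent N v) ≤ ∑ v ∈ I, sumProb ρ N v :=
      measureReal_biUnion_finset_le I _
    linarith
  have hcard : (I.card : ℝ) ≤ 2 * L + 1 := by
    have : I.card ≤ 2 * L + 1 := by rw [Nat.card_Icc]; omega
    exact_mod_cast this
  have hIne : I.Nonempty := ⟨n, Finset.mem_Icc.2 ⟨by omega, by omega⟩⟩
  -- Pigeonhole: the likeliest of at most 2L + 1 values carries at least the average of a total mass
  -- 1/2.
  obtain ⟨v, hv, hmax⟩ := Finset.exists_max_image I (sumProb ρ N) hIne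
  refine ⟨v, (Finset.mem_Icc.1 hv).2, ?_, ?_⟩
  · have := (Finset.mem_Icc.1 hv).1
    omega
  · have h4 : ∑ w ∈ I, sumProb ρ N w ≤ I.card * sumProb ρ N v := by
      simpa using Finset.sum_le_card_nsmul I _ _ hmax
    have h5 := mul_le_mul_of_nonneg_right hcard (sumProb_nonneg ρ N v)
    linarith

/-- A polynomial lower bound, uniform in the law, for the probability that a sum of independent,
identically distributed variables equals its mean. -/
lemma eventually_le_sumProb {c V : ℝ} (hc : 0 < c) (hV : 0 < V) :
    ∀ᶠ N : ℕ in atTop, ∀ (ρ : Measure ℕ) [IsProbabilityMeasure ρ], c ≤ ρ.real {0} →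
      c ≤ ρ.real {1} → MemLp (fun k : ℕ => (k : ℝ)) 2 ρ → ∫ k : ℕ, (k : ℝ) ^ 2 ∂ρ ≤ V →
      ∀ n : ℕ, (N : ℝ) * ∫ k : ℕ, (k : ℝ) ∂ρ = n → 1 / (N : ℝ) ^ 3 ≤ sumProb ρ N n := by
  have tN : Tendsto (fun N : ℕ => (N : ℝ)) atTop atTop := tendsto_natCast_atTop_atTop
  have tlog : Tendsto (fun N : ℕ => √(Real.log N)) atTop atTop :=
    Real.tendsto_sqrt_atTop.comp (Real.tendsto_log_atTop.comp tN)
  have tsqrt : Tendsto (fun N : ℕ => √(N : ℝ)) atTop atTop := Real.tendsto_sqrt_atTop.comp tN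
  have hlog : ∀ᶠ N : ℕ in atTop, Real.log N ≤ c ^ 2 / 48 * N := by
    have := tN.eventually
      (Real.isLittleO_log_id_atTop.bound (show 0 < c ^ 2 / 48 by positivity))
    filter_upwards [this] with N hN
    simp only [Real.norm_eq_abs, id, Nat.abs_cast] at hN
    exact (le_abs_self _).trans hN
  -- The thresholds serve, in order: the final comparison of powers of N, δ ≤ N^(-5), e ≤ 1/4, 2(2L
  -- + 1) ≤ N, and 4Le ≤ log N.
  filter_upwards [eventually_ge_atTop 2, tN.eventually_ge_atTop (4 / c ^ 2), hlog,
    tsqrt.eventually_ge_atTop (4 * √(2 * V) + 6),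
    tlog.eventually_ge_atTop (4 * √3 * (√(2 * V) + 1) / c)] with N hN2 hNc hNlog hNs hNl
    ρ _ h0 h1 hL hρ n hn
  have hN2' : (2 : ℝ) ≤ N := by exact_mod_cast hN2
  have hN0 : (0 : ℝ) < N := by linarith
  obtain ⟨v, hv1, hv2, hv⟩ := exists_le_sumProb ρ hV hL hρ (by omega) hn
  set L := ⌈√(2 * V * N)⌉₊
  set l := Real.log N
  have hl0 : 0 ≤ l := Real.log_nonneg (by linarith)
  set s := √(N : ℝ)
  have hs2 : s ^ 2 = N := Real.sq_sqrt hN0.le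
  have hv0 : 0 ≤ √(2 * V) := Real.sqrt_nonneg _
  have hs1 : 1 ≤ s := by linarith
  have hLle : (L : ℝ) ≤ (√(2 * V) + 1) * s := by
    have h : (L : ℝ) ≤ √(2 * V * N) + 1 := (Nat.ceil_lt_add_one (Real.sqrt_nonneg _)).le
    have hsq : √(2 * V * N) = √(2 * V) * s := Real.sqrt_mul (by positivity) _
    exact h.trans (by rw [hsq]; linarith)
  have hL2 : 2 * (2 * (L : ℝ) + 1) ≤ N := by
    rw [← hs2]
    nlinarith
  have hqv : 1 / (N : ℝ) ≤ sumProb ρ N v := by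
    rw [div_le_iff₀ hN0]
    exact hv.trans (mul_le_mul_of_nonneg_left hL2 (sumProb_nonneg ρ N v))
  -- r² = 3 N log N turns the Hoeffding error into N^(-6), small enough to survive the factors 4/c²
  -- and m ≤ N.
  set r := √3 * s * √l
  have hr0 : 0 ≤ r := by positivity
  have hr2 : r ^ 2 = 3 * N * l := by
    rw [mul_pow, mul_pow, hs2, Real.sq_sqrt hl0, Real.sq_sqrt (by norm_num)]
  set e := r / (c * N) with he
  have he0 : 0 ≤ e := by positivity
  have he4 : e ≤ 1 / 4 := by
    rw [he, div_le_iff₀ (by positivity)]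
    refine abs_le_of_sq_le_sq' ?_ (by positivity) |>.2
    rw [hr2]
    nlinarith
  have hexp : Real.exp (-2 * r ^ 2 / N) = 1 / (N : ℝ) ^ 6 := by
    rw [hr2, show -2 * (3 * N * l) / N = -(((6 : ℕ) : ℝ) * l) by push_cast; field_simp; ring,
      Real.exp_neg, Real.exp_nat_mul, Real.exp_log hN0, one_div]
  set δ := 4 * Real.exp (-2 * r ^ 2 / N) / c ^ 2 with hδ
  have hslow := pow_mul_sub_le_of_slowly_varying (sumProb_nonneg ρ N) he0 (by linarith)
    (show 0 ≤ δ by positivity)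
    (fun u => abs_sumProb_sub_succ_le ρ (by omega) u hr0 hc h0 h1)
  obtain ⟨m, hm, hmn⟩ : ∃ m ≤ L, (1 - 2 * e) ^ m * sumProb ρ N v - m * δ ≤ sumProb ρ N n := by
    rcases le_total v n with hvn | hvn
    · refine ⟨n - v, by omega, ?_⟩
      have := (hslow v (n - v)).1
      rwa [Nat.add_sub_cancel' hvn] at this
    · refine ⟨v - n, by omega, ?_⟩
      have := (hslow n (v - n)).2
      rwa [Nat.add_sub_cancel' hvn] at this
  have hm' : (m : ℝ) ≤ L := by exact_mod_cast hm
  have hpow : 1 / (N : ℝ) ≤ (1 - 2 * e) ^ m := by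
    -- Uses log x ≥ 1 - 1/x and (1 - 2e)(1 + 4e) ≥ 1, the latter valid for 0 ≤ e ≤ 1/4.
    have hbase : Real.exp (-(4 * e)) ≤ 1 - 2 * e := by
      have hx : 0 < 1 - 2 * e := by linarith
      rw [← Real.le_log_iff_exp_le hx]
      refine le_trans ?_ (Real.one_sub_inv_le_log_of_pos hx)
      have : (1 - 2 * e)⁻¹ ≤ 1 + 4 * e := by
        rw [inv_le_iff_one_le_mul₀ hx]
        nlinarith
      linarith
    have hle : (m : ℝ) * (4 * e) ≤ l := by
      have hml := hm'.trans hLle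
      calc (m : ℝ) * (4 * e) ≤ ((√(2 * V) + 1) * s) * (4 * e) := by gcongr
        _ = (4 * √3 * (√(2 * V) + 1) / c) * √l := by
            rw [he, ← hs2]
            have : s ≠ 0 := by positivity
            simp only [r]
            field_simp
        _ ≤ √l * √l := by gcongr
        _ = l := Real.mul_self_sqrt hl0
    calc 1 / (N : ℝ) = Real.exp (-l) := by rw [Real.exp_neg, Real.exp_log hN0, one_div]
      _ ≤ Real.exp (m * -(4 * e)) := Real.exp_le_exp.2 (by linarith)
      _ = Real.exp (-(4 * e)) ^ m := Real.exp_nat_mul _ _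
      _ ≤ (1 - 2 * e) ^ m := pow_le_pow_left₀ (Real.exp_pos _).le hbase m
  have hmain : 1 / (N : ℝ) ^ 2 ≤ (1 - 2 * e) ^ m * sumProb ρ N v := by
    calc 1 / (N : ℝ) ^ 2 = 1 / N * (1 / N) := by field_simp
      _ ≤ _ := mul_le_mul hpow hqv (by positivity) (pow_nonneg (by linarith) m)
  have herr : m * δ ≤ 1 / (N : ℝ) ^ 4 := by
    have hδ' : δ ≤ 1 / (N : ℝ) ^ 5 := by
      calc δ = 4 / c ^ 2 * (1 / (N : ℝ) ^ 6) := by rw [hδ, hexp]; ring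
        _ ≤ N * (1 / (N : ℝ) ^ 6) := by gcongr
        _ = _ := by field_simp
    have hmN : (m : ℝ) ≤ N := by linarith [(Nat.cast_nonneg L : (0 : ℝ) ≤ L)]
    calc m * δ ≤ N * (1 / (N : ℝ) ^ 5) := by gcongr
      _ = _ := by field_simp
  have hfin : 1 / (N : ℝ) ^ 3 ≤ 1 / (N : ℝ) ^ 2 - 1 / (N : ℝ) ^ 4 := by
    have h4 : 0 ≤ ((N : ℝ) ^ 2 - N - 1) / (N : ℝ) ^ 4 := div_nonneg (by nlinarith) (by positivity)
    have h5 : ((N : ℝ) ^ 2 - N - 1) / (N : ℝ) ^ 4 =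
        1 / (N : ℝ) ^ 2 - 1 / (N : ℝ) ^ 3 - 1 / (N : ℝ) ^ 4 := by
      field_simp
    linarith
  linarith

/-! ### Conditional laws given the sum -/

/-- The weight of a configuration, up to factors which depend on its sum only. -/
lemma prod_prob_eq (b : ℕ → ℝ) (θ : ℝ) {N n : ℕ} {x : Fin N → ℕ} (hx : ∑ j, x j = n) :
    ∏ j, prob b θ (x j) = θ ^ n / genFun b θ ^ N * ∏ j, (b (x j) / ((x j).factorial : ℝ)) := by
  have : ∀ k, prob b θ k = θ ^ k * (b k / (k.factorial : ℝ)) / genFun b θ := by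
    intro k; rw [prob, term]; ring
  simp only [this, Finset.prod_div_distrib, Finset.prod_mul_distrib, Finset.prod_pow_eq_pow_sum, hx,
    Finset.prod_const, Finset.card_univ, Fintype.card_fin]
  ring

namespace Regular

variable {b : ℕ → ℝ} {t θ : ℝ}

lemma isProbabilityMeasure_xiVecLaw (h : Regular b t) (h0 : 0 ≤ θ) (h1 : θ ≤ t) (N : ℕ) :
    IsProbabilityMeasure (xiVecLaw b θ N) := by
  have := h.isProbabilityMeasure h0 h1
  unfold xiVecLaw
  infer_instance

lemma xiVecLaw_singleton (h : Regular b t) (h0 : 0 ≤ θ) (h1 : θ ≤ t) {N : ℕ} (x : Fin N → ℕ) :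
    xiVecLaw b θ N {x} = ENNReal.ofReal (∏ j, prob b θ (x j)) := by
  have := h.isProbabilityMeasure h0 h1
  rw [xiVecLaw, Measure.pi_singleton, ENNReal.ofReal_prod_of_nonneg
    fun j _ => h.prob_nonneg h0 h1 _]
  exact Finset.prod_congr rfl fun j _ => xiLaw_singleton b θ _

/-- On the event that the sum is `n`, the laws for different parameters are proportional. -/
lemma exists_restrict_eq_smul {t' θ' : ℝ} (h : Regular b t) (h0 : 0 < θ) (h1 : θ ≤ t)
    (h' : Regular b t') (h0' : 0 < θ') (h1' : θ' ≤ t') (N n : ℕ) :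
    ∃ a : ENNReal, a ≠ 0 ∧ a ≠ ⊤ ∧ (xiVecLaw b θ N).restrict (sumEvent N n) =
      a • (xiVecLaw b θ' N).restrict (sumEvent N n) := by
  have g := h.genFun_pos h0.le h1
  have g' := h'.genFun_pos h0'.le h1'
  set C := θ ^ n / genFun b θ ^ N
  set C' := θ' ^ n / genFun b θ' ^ N
  have hC : 0 < C := by positivity
  have hC' : 0 < C' := by positivity
  refine ⟨ENNReal.ofReal (C / C'), by simpa using div_pos hC hC', ENNReal.ofReal_ne_top, ?_⟩
  refine Measure.ext_of_singleton fun x => ?_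
  rw [Measure.smul_apply, Measure.restrict_apply (measurableSet_singleton x),
    Measure.restrict_apply (measurableSet_singleton x), smul_eq_mul]
  by_cases hx : x ∈ sumEvent N n
  · rw [Set.inter_eq_left.2 (Set.singleton_subset_iff.2 hx), h.xiVecLaw_singleton h0.le h1,
      h'.xiVecLaw_singleton h0'.le h1', prod_prob_eq b θ hx, prod_prob_eq b θ' hx,
      ← ENNReal.ofReal_mul (div_pos hC hC').le, ← mul_assoc]
    congr 2
    change C = C / C' * C'
    field_simp
  · rw [Set.singleton_inter_eq_empty.2 hx]
    simp

/-- Proportional restrictions have proportional total masses. This lets the scheme, assumed only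
where its conditioning events have positive probability, be invoked once the lower bound holds for
the mean-matched parameters. -/
lemma xiVecLaw_sumEvent_pos {t' θ' : ℝ} (h : Regular b t) (h0 : 0 < θ) (h1 : θ ≤ t)
    (h' : Regular b t') (h0' : 0 < θ') (h1' : θ' ≤ t') {N n : ℕ}
    (hpos : 0 < xiVecLaw b θ' N (sumEvent N n)) : 0 < xiVecLaw b θ N (sumEvent N n) := by
  obtain ⟨a, ha0, -, ha⟩ := h.exists_restrict_eq_smul h0 h1 h' h0' h1' N n
  have := congrArg (fun μ => μ Set.univ) ha
  simp only [Measure.restrict_apply_univ, Measure.smul_apply, smul_eq_mul] at this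
  rw [this]
  exact ENNReal.mul_pos ha0 hpos.ne'

/-- The conditional law given the sum does not depend on the parameter. -/
lemma cond_xiVecLaw_eq {t' θ' : ℝ} (h : Regular b t) (h0 : 0 < θ) (h1 : θ ≤ t)
    (h' : Regular b t') (h0' : 0 < θ') (h1' : θ' ≤ t') (N n : ℕ) :
    cond (xiVecLaw b θ N) (sumEvent N n) = cond (xiVecLaw b θ' N) (sumEvent N n) := by
  obtain ⟨a, ha0, hat, ha⟩ := h.exists_restrict_eq_smul h0 h1 h' h0' h1' N n
  have hu := congrArg (fun μ => μ Set.univ) ha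
  simp only [Measure.restrict_apply_univ, Measure.smul_apply, smul_eq_mul] at hu
  rw [ProbabilityTheory.cond, ProbabilityTheory.cond, ha, hu, smul_smul,
    ENNReal.mul_inv (Or.inl ha0) (Or.inl hat), mul_right_comm, ENNReal.inv_mul_cancel ha0 hat,
    one_mul]

/-- The bound of `eventually_le_sumProb` for power series distributions with means bounded away
from `0` and parameters at most `t`. -/
lemma eventually_le_xiVecLaw (h : Regular b t) {a : ℝ} (ha : 0 < a) :
    ∀ᶠ N : ℕ in atTop, ∀ θ, 0 ≤ θ → θ ≤ t → a ≤ mean b θ → ∀ n : ℕ, (N : ℝ) * mean b θ = n →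
      1 / (N : ℝ) ^ 3 ≤ (xiVecLaw b θ N).real (sumEvent N n) := by
  obtain ⟨c, hc, hcθ⟩ := h.exists_le_of_le_mean ha
  obtain ⟨p, hp, hpθ⟩ := h.exists_le_prob hc
  obtain ⟨V, hV, hVθ⟩ := h.exists_integral_sq_le
  filter_upwards [eventually_le_sumProb hp hV] with N hN θ h0 h1 hm n hn
  have := h.isProbabilityMeasure h0 h1
  have hreal : ∀ k, (xiLaw b θ).real {k} = prob b θ k := fun k => by
    rw [measureReal_def, xiLaw_singleton, ENNReal.toReal_ofReal (h.prob_nonneg h0 h1 k)]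
  have hL : MemLp (fun k : ℕ => (k : ℝ)) 2 (xiLaw b θ) := by
    rw [memLp_two_iff_integrable_sq measurable_from_top.aestronglyMeasurable]
    exact h.integrable h0 h1 fun k => by
      rw [abs_of_nonneg (by positivity)]; nlinarith [(Nat.cast_nonneg k : (0 : ℝ) ≤ k)]
  have hpp := hpθ θ (hcθ θ h0 h1 hm) h1
  exact hN (xiLaw b θ) (by rw [hreal]; exact hpp.1) (by rw [hreal]; exact hpp.2) hL
    (hVθ θ h0 h1) n hn

end Regular

/-! ### The allocation scheme -/

lemma measure_le_of_singleton {X : Type*} [Countable X] [MeasurableSpace X]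
    [MeasurableSingletonClass X] {μ ν : Measure X} (h : ∀ x, μ {x} ≤ ν {x}) : μ ≤ ν := by
  refine Measure.le_iff.2 fun A hA => ?_
  rw [← Measure.tsum_indicator_apply_singleton μ A hA,
    ← Measure.tsum_indicator_apply_singleton ν A hA]
  exact ENNReal.tsum_le_tsum fun x => Set.indicator_le_indicator (h x)

/-- A law on a countable product is bounded by a product law if the two agree at the points of a
box of full product measure. -/
lemma map_le_pi {Ω ι X : Type*} [MeasurableSpace Ω] [Fintype ι] [Countable X] [MeasurableSpace X]
    [MeasurableSingletonClass X] (P : Measure Ω) [IsProbabilityMeasure P]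
    (ν : ι → Measure X) [∀ i, IsProbabilityMeasure (ν i)] (T : ι → Set X) (hT : ∀ i, ν i (T i) = 1)
    {Y : Ω → ι → X} (hY : Measurable Y)
    (h : ∀ k : ι → X, (∀ i, k i ∈ T i) → P (Y ⁻¹' {k}) = ∏ i, ν i {k i}) :
    P.map Y ≤ Measure.pi ν := by
  have hprob : IsProbabilityMeasure (P.map Y) := Measure.isProbabilityMeasure_map hY.aemeasurable
  set B : Set (ι → X) := Set.univ.pi T
  have hB : MeasurableSet B := B.to_countable.measurableSet
  have hres : (P.map Y).restrict B = (Measure.pi ν).restrict B := by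
    refine Measure.ext_of_singleton fun k => ?_
    rw [Measure.restrict_apply (measurableSet_singleton k),
      Measure.restrict_apply (measurableSet_singleton k)]
    by_cases hk : k ∈ B
    · rw [Set.inter_eq_left.2 (Set.singleton_subset_iff.2 hk),
        Measure.map_apply hY (measurableSet_singleton k), Measure.pi_singleton]
      exact h k fun i => hk i (Set.mem_univ i)
    · rw [Set.singleton_inter_eq_empty.2 hk]
      simp
  have hpiB : Measure.pi ν B = 1 := by
    rw [Measure.pi_pi]
    simp [hT]
  -- The two laws agree on the box and the product law already has mass 1 there, so the law of `Y`
  -- has no mass left outside.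
  have hmapB : P.map Y B = 1 := by
    have := congrArg (fun μ => μ Set.univ) hres
    simp only [Measure.restrict_apply_univ] at this
    rw [this, hpiB]
  have hcompl : P.map Y Bᶜ = 0 := (prob_compl_eq_zero_iff hB).2 hmapB
  have hre : (P.map Y).restrict B = P.map Y :=
    Measure.restrict_eq_self_of_ae_mem (by rwa [ae_iff])
  rw [← hre, hres]
  exact Measure.restrict_le_self

/-- Concentration of the number of boxes with given contents, when the sums which are conditioned
on have at least polynomial probability for some parameters. -/
lemma ObeysScheme.exists_measureReal_boxCount_le {Ω : Type*} [MeasurableSpace Ω] {P : Measure Ω}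
    [IsProbabilityMeasure P] {K N : ℕ} {b : Fin K → ℕ → ℝ} {θ : Fin K → ℝ} {n : Fin K → ℕ}
    {η : Fin K → Fin N → Ω → ℕ} (hS : ObeysScheme P b θ n N η) (hη : ∀ i j, Measurable (η i j))
    (hθ : ∀ i, Regular (b i) (θ i)) {t ϑ : Fin K → ℝ} (ht : ∀ i, Regular (b i) (t i))
    (h0 : ∀ i, 0 < ϑ i) (h1 : ∀ i, ϑ i ≤ t i) (hN : 0 < N)
    (hlow : ∀ i, 1 / (N : ℝ) ^ 3 ≤ (xiVecLaw (b i) (ϑ i) N).real (sumEvent N (n i)))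
    (s : Fin K → ℕ) {r : ℝ} (hr : 0 ≤ r) :
    ∃ p ∈ Set.Icc (0 : ℝ) 1, P.real {ω | r ≤ |boxCount η s ω - N * p|} ≤
      ((N : ℝ) ^ 3) ^ K * (2 * Real.exp (-2 * r ^ 2 / N)) := by
  have hN' : (0 : ℝ) < N := by exact_mod_cast hN
  have hξ : ∀ i, IsProbabilityMeasure (xiLaw (b i) (ϑ i)) := fun i =>
    (ht i).isProbabilityMeasure (h0 i).le (h1 i)
  have hξN : ∀ i, IsProbabilityMeasure (xiVecLaw (b i) (ϑ i) N) := fun i =>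
    (ht i).isProbabilityMeasure_xiVecLaw (h0 i).le (h1 i) N
  -- `ρ` is the law of one box over all colours, and `Q` makes the boxes independent; arrays are
  -- indexed box first here and colour first in the scheme, hence the transposition `σ` below.
  set ρ : Measure (Fin K → ℕ) := Measure.pi fun i => xiLaw (b i) (ϑ i)
  set Q : Measure (Fin N → Fin K → ℕ) := Measure.pi fun _ => ρ
  set f : (Fin K → ℕ) → ℝ := fun y => ∏ i, if y i = s i then (1 : ℝ) else 0
  have hf : Measurable f := measurable_of_countable f
  have hf01 : ∀ y, f y ∈ Set.Icc (0 : ℝ) 1 := fun y =>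
    ⟨Finset.prod_nonneg fun i _ => by split_ifs <;> norm_num,
      Finset.prod_le_one (fun i _ => by split_ifs <;> norm_num)
        fun i _ => by split_ifs <;> norm_num⟩
  refine ⟨∫ y, f y ∂ρ, ⟨integral_nonneg fun y => (hf01 y).1, ?_⟩, ?_⟩
  · have := integral_mono (μ := ρ) (Integrable.of_mem_Icc 0 1 hf.aemeasurable
      (Eventually.of_forall hf01)) (integrable_const 1) fun y => (hf01 y).2
    simpa using this
  set p := ∫ y, f y ∂ρ
  have hhoeff := measureReal_abs_sum_sub_ge_le ρ hf hf01 N hr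
  have hSpos : ∀ i, xiVecLaw (b i) (ϑ i) N (sumEvent N (n i)) ≠ 0 := by
    intro i h
    have := hlow i
    rw [measureReal_def, h, ENNReal.toReal_zero] at this
    exact absurd this (not_le.2 (by positivity))
  set ν : Fin K → Measure (Fin N → ℕ) := fun i =>
    cond (xiVecLaw (b i) (ϑ i) N) (sumEvent N (n i))
  have hmeasS : ∀ i, MeasurableSet (sumEvent N (n i)) := fun i =>
    (Set.to_countable _).measurableSet
  have hν : ∀ i, IsProbabilityMeasure (ν i) := fun i => cond_isProbabilityMeasure (hSpos i)
  set Y : Ω → Fin K → Fin N → ℕ := fun ω i j => η i j ω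
  have hY : Measurable Y := measurable_pi_lambda _ fun i => measurable_pi_lambda _ fun j => hη i j
  have hmap : P.map Y ≤ Measure.pi ν := by
    refine map_le_pi P ν (fun i => sumEvent N (n i))
      (fun i => cond_apply_self (hSpos i) (measure_ne_top _ _)) hY fun k hk => ?_
    have hset : Y ⁻¹' {k} = {ω | ∀ i j, η i j ω = k i j} := by
      ext ω
      simp [Y, funext_iff]
    rw [hset, hS k hk]
    exact Finset.prod_congr rfl fun i _ => by
      rw [(hθ i).cond_xiVecLaw_eq (hθ i).pos le_rfl (ht i) (h0 i) (h1 i)]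
  set c : ENNReal := ENNReal.ofReal ((N : ℝ) ^ 3)
  set σ : (Fin N → Fin K → ℕ) → Fin K → Fin N → ℕ := fun x i j => x j i
  have hσ : Measurable σ := measurable_pi_lambda _ fun i => measurable_pi_lambda _ fun j =>
    (measurable_pi_apply i).comp (measurable_pi_apply j)
  have hdom : Measure.pi ν ≤ c ^ K • Q.map σ := by
    refine measure_le_of_singleton fun k => ?_
    have hσk : σ ⁻¹' {k} = {fun j i => k i j} := by
      ext x
      simp only [Set.mem_preimage, Set.mem_singleton_iff, funext_iff, σ]
      exact forall_comm
    -- Conditioning divides by a probability that is at least N^(-3).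
    have hνk : ∀ i, ν i {k i} ≤ c * ∏ j, xiLaw (b i) (ϑ i) {k i j} := by
      intro i
      rw [cond_apply (hmeasS i)]
      refine mul_le_mul' ?_ ?_
      · rw [ENNReal.inv_le_iff_inv_le, ← ENNReal.ofReal_inv_of_pos (by positivity), ← one_div]
        exact (ENNReal.ofReal_le_iff_le_toReal (measure_ne_top _ _)).2 (hlow i)
      · refine (measure_mono Set.inter_subset_right).trans (le_of_eq ?_)
        rw [xiVecLaw, Measure.pi_singleton]
    rw [Measure.smul_apply, Measure.map_apply hσ (measurableSet_singleton k), hσk,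
      Measure.pi_singleton, Measure.pi_singleton, smul_eq_mul]
    simp only [ρ, Measure.pi_singleton]
    refine (Finset.prod_le_prod' fun i _ => hνk i).trans (le_of_eq ?_)
    rw [Finset.prod_mul_distrib, Finset.prod_const, Finset.card_univ, Fintype.card_fin,
      Finset.prod_comm]
  set B : Set (Fin K → Fin N → ℕ) := {k | r ≤ |∑ j, f (fun i => k i j) - N * p|}
  have hB : MeasurableSet B := B.to_countable.measurableSet
  have hP : P {ω | r ≤ |boxCount η s ω - N * p|} ≤
      c ^ K * Q {x | r ≤ |∑ j, f (x j) - N * p|} := by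
    have h2 := (hmap.trans hdom) B
    rwa [Measure.map_apply hY hB, Measure.smul_apply, smul_eq_mul, Measure.map_apply hσ hB] at h2
  have htop : c ^ K * Q {x | r ≤ |∑ j, f (x j) - N * p|} ≠ ⊤ :=
    ENNReal.mul_ne_top (ENNReal.pow_ne_top ENNReal.ofReal_ne_top) (measure_ne_top _ _)
  have h3 := ENNReal.toReal_mono htop hP
  rw [ENNReal.toReal_mul, ENNReal.toReal_pow, ENNReal.toReal_ofReal (by positivity)] at h3
  exact h3.trans (mul_le_mul_of_nonneg_left hhoeff (by positivity))

/-! ### From tail bounds to almost sure bounds, uniformly over the sector -/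

lemma boxCount_mem {Ω : Type*} {K N : ℕ} (η : Fin K → Fin N → Ω → ℕ) (s : Fin K → ℕ) (ω : Ω) :
    boxCount η s ω ∈ Set.Icc (0 : ℝ) N := by
  constructor
  · exact Finset.sum_nonneg fun j _ => Finset.prod_nonneg fun i _ => by split_ifs <;> norm_num
  · calc boxCount η s ω ≤ ∑ _j : Fin N, (1 : ℝ) := Finset.sum_le_sum fun j _ =>
          Finset.prod_le_one (fun i _ => by split_ifs <;> norm_num)
            fun i _ => by split_ifs <;> norm_num
      _ = N := by simp

lemma measurable_boxCount {Ω : Type*} [MeasurableSpace Ω] {K N : ℕ} {η : Fin K → Fin N → Ω → ℕ}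
    (hη : ∀ i j, Measurable (η i j)) (s : Fin K → ℕ) : Measurable (boxCount η s) := by
  unfold boxCount
  refine Finset.measurable_sum _ fun j _ => Finset.measurable_prod _ fun i _ => ?_
  exact (measurable_from_top (f := fun k : ℕ => if k = s i then (1 : ℝ) else 0)).comp (hη i j)

/-- A variable with values in `[0, N]` which is close to `a ∈ [0, N]` with high probability has a
mean close to `a`. -/
lemma abs_integral_sub_le {Ω : Type*} [MeasurableSpace Ω] {P : Measure Ω} [IsProbabilityMeasure P]
    {X : Ω → ℝ} (hX : Measurable X) {M a r : ℝ} (hXM : ∀ ω, X ω ∈ Set.Icc 0 M)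
    (ha : a ∈ Set.Icc 0 M) (hr : 0 ≤ r) :
    |∫ ω, X ω ∂P - a| ≤ r + M * P.real {ω | r ≤ |X ω - a|} := by
  have hXi : Integrable X P :=
    Integrable.of_mem_Icc 0 M hX.aemeasurable (Eventually.of_forall hXM)
  set A := {ω | r ≤ |X ω - a|}
  have hA : MeasurableSet A := measurableSet_le measurable_const (hX.sub_const a).abs
  have hpt : ∀ ω, |X ω - a| ≤ r + A.indicator (fun _ => M) ω := by
    intro ω
    by_cases hω : ω ∈ A
    · rw [Set.indicator_of_mem hω, abs_le]
      obtain ⟨h1, h2⟩ := hXM ω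
      obtain ⟨h3, h4⟩ := ha
      constructor <;> linarith
    · rw [Set.indicator_of_notMem hω, add_zero]
      exact (not_le.1 hω).le
  have hind : Integrable (A.indicator fun _ => M) P := (integrable_const M).indicator hA
  calc |∫ ω, X ω ∂P - a| = |∫ ω, (X ω - a) ∂P| := by
        rw [integral_sub hXi (integrable_const a)]
        simp
    _ ≤ ∫ ω, |X ω - a| ∂P := abs_integral_le_integral_abs
    _ ≤ ∫ ω, (r + A.indicator (fun _ => M) ω) ∂P :=
        integral_mono (hXi.sub (integrable_const a)).abs ((integrable_const r).add hind) hpt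
    _ = r + M * P.real A := by
        rw [integral_add (integrable_const r) hind, integral_indicator_const _ hA]
        simp [mul_comm]

/-- Concentration of the box counts, uniformly over the sector. -/
lemma eventually_measureReal_boxCount_le {Ω : Type*} [MeasurableSpace Ω] {P : Measure Ω}
    [IsProbabilityMeasure P] {K : ℕ} {b : Fin K → ℕ → ℝ} {α' α'' t : Fin K → ℝ}
    (hα' : ∀ i, 0 < α' i) (ht : ∀ i, Regular (b i) (t i)) (hm : ∀ i, mean (b i) (t i) = α'' i)
    (s : Fin K → ℕ) {θ : (Fin K → ℕ) → ℕ → Fin K → ℝ}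
    (hθ : ∀ n N, (n, N) ∈ sector α' α'' → ∀ i, Regular (b i) (θ n N i))
    {η : (n : Fin K → ℕ) → (N : ℕ) → Fin K → Fin N → Ω → ℕ}
    (hηm : ∀ n N i j, Measurable (η n N i j))
    (hη : ∀ n N, (n, N) ∈ sector α' α'' →
      (∀ i, 0 < xiVecLaw (b i) (θ n N i) N (sumEvent N (n i))) →
      ObeysScheme P b (θ n N) n N (η n N)) :
    ∀ᶠ N : ℕ in atTop, ∀ n, (n, N) ∈ sector α' α'' → ∃ p ∈ Set.Icc (0 : ℝ) 1,
      P.real {ω | √(2 * K + 1) * √(N * Real.log N) ≤ |boxCount (η n N) s ω - N * p|} ≤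
        2 / (N : ℝ) ^ (K + 2) := by
  have hev := eventually_all.2 fun i => (ht i).eventually_le_xiVecLaw (hα' i)
  filter_upwards [hev, eventually_ge_atTop 1] with N hN hN1 n hn
  have hN0 : (0 : ℝ) < N := by exact_mod_cast hN1
  have hϑ : ∀ i, ∃ ϑ, 0 < ϑ ∧ ϑ ≤ t i ∧ mean (b i) ϑ = (n i : ℝ) / N := fun i =>
    (ht i).exists_mean_eq ((hα' i).trans (hn i).1) (by rw [hm]; exact (hn i).2)
  choose ϑ h0 h1 hϑm using hϑ
  have hlow : ∀ i, 1 / (N : ℝ) ^ 3 ≤ (xiVecLaw (b i) (ϑ i) N).real (sumEvent N (n i)) := fun i =>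
    hN i (ϑ i) (h0 i).le (h1 i) (by rw [hϑm]; exact (hn i).1.le) (n i)
      (by rw [hϑm]; field_simp)
  have hpos : ∀ i, 0 < xiVecLaw (b i) (θ n N i) N (sumEvent N (n i)) := by
    intro i
    refine (hθ n N hn i).xiVecLaw_sumEvent_pos (hθ n N hn i).pos le_rfl (ht i) (h0 i) (h1 i) ?_
    rw [pos_iff_ne_zero]
    intro h
    have := hlow i
    rw [measureReal_def, h, ENNReal.toReal_zero] at this
    exact absurd this (not_le.2 (by positivity))
  obtain ⟨p, hp, hle⟩ := (hη n N hn hpos).exists_measureReal_boxCount_le (hηm n N) (hθ n N hn) ht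
    h0 h1 hN1 hlow s (show 0 ≤ √(2 * (K : ℝ) + 1) * √(N * Real.log N) by positivity)
  refine ⟨p, hp, hle.trans (le_of_eq ?_)⟩
  have hl : 0 ≤ Real.log N := Real.log_nonneg (by exact_mod_cast hN1)
  -- Of the exponent 4K + 2, conditioning consumes 3K. The remaining K + 2 pays for counting the
  -- O(N^K) vectors and leaves a summable N^(-2).
  have hexp : Real.exp (-2 * (√(2 * (K : ℝ) + 1) * √(N * Real.log N)) ^ 2 / N) =
      1 / (N : ℝ) ^ (4 * K + 2) := by
    rw [mul_pow, Real.sq_sqrt (by positivity), Real.sq_sqrt (by positivity),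
      show -2 * ((2 * (K : ℝ) + 1) * (N * Real.log N)) / N =
        -(((4 * K + 2 : ℕ) : ℝ) * Real.log N) by push_cast; field_simp; ring,
      Real.exp_neg, Real.exp_nat_mul, Real.exp_log hN0, one_div]
  rw [hexp, ← pow_mul, mul_one_div, mul_div_assoc', div_eq_div_iff (by positivity) (by positivity)]
  ring

/-- Almost surely, the deviation bound holds in the whole sector for all large `N`. -/
lemma ae_eventually_abs_boxCount_sub_lt {Ω : Type*} [MeasurableSpace Ω] {P : Measure Ω}
    [IsProbabilityMeasure P] {K : ℕ} {α' α'' : Fin K → ℝ} (X : (Fin K → ℕ) → ℕ → Ω → ℝ)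
    (a : (Fin K → ℕ) → ℕ → ℝ) (r : ℕ → ℝ) {N₀ : ℕ}
    (h : ∀ N ≥ N₀, ∀ n, (n, N) ∈ sector α' α'' →
      P.real {ω | r N ≤ |X n N ω - a n N|} ≤ 2 / (N : ℝ) ^ (K + 2)) :
    ∀ᵐ ω ∂P, ∀ᶠ N : ℕ in atTop, ∀ n, (n, N) ∈ sector α' α'' → |X n N ω - a n N| < r N := by
  obtain ⟨M, hM⟩ : ∃ M : ℕ, ∀ i, α'' i ≤ M := by
    obtain ⟨M, hM⟩ := exists_nat_ge (∑ i, |α'' i|)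
    exact ⟨M, fun i => (le_abs_self _).trans ((Finset.single_le_sum
      (f := fun i => |α'' i|) (fun j _ => abs_nonneg _) (Finset.mem_univ i)).trans hM)⟩
  set F : ℕ → Finset (Fin K → ℕ) := fun N => Fintype.piFinset fun _ => Finset.range (M * N)
  -- The condition `1 ≤ N` makes `E 0` empty, as required by the bound below, whose value at `N = 0`
  -- is 0 because of division by zero.
  set E : ℕ → Set Ω := fun N => ⋃ n ∈ F N,
    {ω | N₀ ≤ N ∧ 1 ≤ N ∧ (n, N) ∈ sector α' α'' ∧ r N ≤ |X n N ω - a n N|}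
  have hE : ∀ N, P (E N) ≤ ENNReal.ofReal (2 * M ^ K * (1 / (N : ℝ) ^ 2)) := by
    intro N
    by_cases hN : N₀ ≤ N ∧ 1 ≤ N
    · have hN0 : (0 : ℝ) < N := by exact_mod_cast hN.2
      have hn : ∀ n, P {ω | N₀ ≤ N ∧ 1 ≤ N ∧ (n, N) ∈ sector α' α'' ∧ r N ≤ |X n N ω - a n N|} ≤
          ENNReal.ofReal (2 / (N : ℝ) ^ (K + 2)) := by
        intro n
        by_cases hs : (n, N) ∈ sector α' α''
        · refine (measure_mono fun ω hω => hω.2.2.2).trans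
            ((ENNReal.le_ofReal_iff_toReal_le (measure_ne_top _ _) (by positivity)).2
              (h N hN.1 n hs))
        · simp [hs]
      calc P (E N) ≤ ∑ n ∈ F N, _ := measure_biUnion_finset_le _ _
        _ ≤ ∑ _n ∈ F N, ENNReal.ofReal (2 / (N : ℝ) ^ (K + 2)) := Finset.sum_le_sum fun n _ => hn n
        _ = ENNReal.ofReal (∑ _n ∈ F N, 2 / (N : ℝ) ^ (K + 2)) :=
            (ENNReal.ofReal_sum_of_nonneg fun _ _ => by positivity).symm
        _ = _ := by
            congr 1
            simp only [F, Finset.sum_const, Fintype.card_piFinset, Finset.card_range,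
              Finset.prod_const, Finset.card_univ, Fintype.card_fin, nsmul_eq_mul]
            push_cast
            field_simp
            ring
    · have : E N = ∅ := by
        simp only [E, Set.iUnion_eq_empty]
        intro n _
        ext ω
        simp only [Set.mem_ofPred_eq, Set.mem_empty_iff_false, iff_false]
        tauto
      rw [this, measure_empty]
      exact zero_le
  have hsum : ∑' N, P (E N) ≠ ⊤ := by
    refine ne_top_of_le_ne_top ?_ (ENNReal.tsum_le_tsum hE)
    exact ((Real.summable_one_div_nat_pow.2 one_lt_two).mul_left _).tsum_ofReal_ne_top
  filter_upwards [ae_eventually_notMem hsum] with ω hω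
  filter_upwards [hω, eventually_ge_atTop N₀, eventually_ge_atTop 1] with N hN hN0 hN1 n hn
  by_contra hlt
  refine hN (Set.mem_biUnion (x := n) ?_ ⟨hN0, hN1, hn, not_lt.1 hlt⟩)
  simp only [F, Finset.mem_coe, Fintype.mem_piFinset, Finset.mem_range]
  intro i
  have hNpos : (0 : ℝ) < N := by exact_mod_cast hN1
  have h1 : (n i : ℝ) / N < M := (hn i).2.trans_le (hM i)
  rw [div_lt_iff₀ hNpos] at h1
  exact_mod_cast h1

lemma tendsto_snd_sectorAtTop {K : ℕ} (α' α'' : Fin K → ℝ) :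
    Tendsto (fun x : (Fin K → ℕ) × ℕ => x.2) (sectorAtTop α' α'') atTop := by
  refine Tendsto.mono_left ?_ inf_le_left
  rw [← prod_atTop_atTop_eq]
  exact tendsto_snd

end MultiColour

end

/-! ### Centring at the expectation and the limit along the sector -/

theorem corollary1p1
    {Ω : Type*} [MeasurableSpace Ω] (P : Measure Ω) [IsProbabilityMeasure P]
    (K : ℕ) (hK : 0 < K)
    (b : Fin K → ℕ → ℝ) (hb : ∀ i k, 0 ≤ b i k)
    (hb0 : ∀ i, 0 < b i 0) (hb1 : ∀ i, 0 < b i 1)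
    (hR : ∀ i, 0 < MultiColour.convRadius (b i))
    (α' α'' : Fin K → ℝ) (hα' : ∀ i, 0 < α' i) (hα : ∀ i, α' i < α'' i)
    -- the inverse of the mean function is defined at `α'' i`, with a value below the radius
    (hα'' : ∀ i, ∃ t : ℝ, 0 < t ∧ ENNReal.ofReal t < MultiColour.convRadius (b i) ∧
      MultiColour.mean (b i) t = α'' i)
    (s : Fin K → ℕ) (hs : ∀ i, 0 < b i (s i))
    -- the parameters of the power series distributions, possibly depending on `(n, N)`
    (θ : (Fin K → ℕ) → ℕ → Fin K → ℝ)
    (hθ : ∀ n N, (n, N) ∈ MultiColour.sector α' α'' →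
      ∀ i, 0 < θ n N i ∧ ENNReal.ofReal (θ n N i) < MultiColour.convRadius (b i))
    -- the box contents, for all `(n, N)` on one probability space
    (η : (n : Fin K → ℕ) → (N : ℕ) → Fin K → Fin N → Ω → ℕ)
    (hηm : ∀ n N i j, Measurable (η n N i j))
    -- the scheme is obeyed wherever in the sector its conditional probabilities are defined
    (hη : ∀ n N, (n, N) ∈ MultiColour.sector α' α'' →
      (∀ i, 0 < MultiColour.xiVecLaw (b i) (θ n N i) N (MultiColour.sumEvent N (n i))) →
      MultiColour.ObeysScheme P b (θ n N) n N (η n N))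
    (d : ℕ → ℝ) (hd0 : ∀ᶠ N in atTop, d N ≠ 0)
    (hd : Tendsto (fun N : ℕ => Real.sqrt ((N : ℝ) * Real.log (N : ℝ)) / d N) atTop (𝓝 0)) :
    ∀ᵐ ω ∂P, Tendsto
      (fun x : (Fin K → ℕ) × ℕ =>
        (MultiColour.boxCount (η x.1 x.2) s ω
          - ∫ ω', MultiColour.boxCount (η x.1 x.2) s ω' ∂P) / d x.2)
      (MultiColour.sectorAtTop α' α'') (𝓝 0) := by
  choose t ht0 htR htm using hα''
  have hreg : ∀ i (ϑ : ℝ), 0 < ϑ → ENNReal.ofReal ϑ < MultiColour.convRadius (b i) →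
      MultiColour.Regular (b i) ϑ := fun i ϑ h0 hϑ =>
    ⟨hb i, hb0 i, hb1 i, h0, MultiColour.summable_sq_mul_term (hb i) h0.le hϑ⟩
  have hconc := MultiColour.eventually_measureReal_boxCount_le hα'
    (fun i => hreg i _ (ht0 i) (htR i)) htm s
    (fun n N hn i => hreg i _ (hθ n N hn i).1 (hθ n N hn i).2) hηm hη
  obtain ⟨N₀, hN₀⟩ := eventually_atTop.1 hconc
  -- Makes the centre a total function of the pair, with default value 0 where no bound is
  -- available.
  have hex : ∀ (n : Fin K → ℕ) (N : ℕ), ∃ p : ℝ, N₀ ≤ N → (n, N) ∈ MultiColour.sector α' α'' →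
      p ∈ Set.Icc (0 : ℝ) 1 ∧ P.real {ω | √(2 * K + 1) * √(N * Real.log N) ≤
        |MultiColour.boxCount (η n N) s ω - N * p|} ≤ 2 / (N : ℝ) ^ (K + 2) := by
    intro n N
    by_cases h : N₀ ≤ N ∧ (n, N) ∈ MultiColour.sector α' α''
    · obtain ⟨p, hp⟩ := hN₀ N h.1 n h.2
      exact ⟨p, fun _ _ => hp⟩
    · exact ⟨0, fun h1 h2 => absurd ⟨h1, h2⟩ h⟩
  choose p hp using hex
  have hae := MultiColour.ae_eventually_abs_boxCount_sub_lt (P := P) (α' := α') (α'' := α'')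
    (fun n N => MultiColour.boxCount (η n N) s) (fun n N => N * p n N)
    (fun N => √(2 * K + 1) * √(N * Real.log N)) (N₀ := N₀) fun N hN n hn => (hp n N hN hn).2
  filter_upwards [hae] with ω hω
  have hsnd := MultiColour.tendsto_snd_sectorAtTop α' α''
  have hg : Tendsto (fun x : (Fin K → ℕ) × ℕ => 3 * √(2 * (K : ℝ) + 1) *
      |√((x.2 : ℝ) * Real.log x.2) / d x.2|) (MultiColour.sectorAtTop α' α'') (𝓝 0) := by
    have := ((hd.abs).const_mul (3 * √(2 * (K : ℝ) + 1))).comp hsnd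
    simp only [abs_zero, mul_zero] at this
    exact this
  refine squeeze_zero_norm' ?_ hg
  have hsec : ∀ᶠ x in MultiColour.sectorAtTop α' α'', x ∈ MultiColour.sector α' α'' :=
    mem_inf_of_right (mem_principal_self _)
  filter_upwards [hsec, hsnd.eventually hω, hsnd.eventually (eventually_ge_atTop N₀),
    hsnd.eventually (eventually_ge_atTop 3)] with x hx hxω hxN hx3
  obtain ⟨n, N⟩ := x
  change 3 ≤ N at hx3
  change N₀ ≤ N at hxN
  simp only at hxω ⊢
  obtain ⟨hp01, hpP⟩ := hp n N hxN hx
  set X := MultiColour.boxCount (η n N) s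
  set r := √(2 * (K : ℝ) + 1) * √(N * Real.log N) with hr
  have hN3 : (3 : ℝ) ≤ N := by exact_mod_cast hx3
  have hN0 : (0 : ℝ) < N := by linarith
  -- N ≥ 3 > exp 1 gives log N ≥ 1. With r ≥ 1, the error r + 1 in replacing N p by the expectation
  -- is at most 2r.
  have hr1 : 1 ≤ r := by
    have hl : 1 ≤ Real.log N := by
      rw [Real.le_log_iff_exp_le hN0]
      linarith [Real.exp_one_lt_d9]
    have h1 : 1 ≤ √(2 * (K : ℝ) + 1) := Real.one_le_sqrt.2 (by
      linarith [(Nat.cast_nonneg K : (0 : ℝ) ≤ K)])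
    have h2 : 1 ≤ √(N * Real.log N) := Real.one_le_sqrt.2 (by nlinarith)
    exact one_le_mul_of_one_le_of_one_le h1 h2
  have hmean := MultiColour.abs_integral_sub_le (P := P) (X := X) (r := r)
    (MultiColour.measurable_boxCount (hηm n N) s) (MultiColour.boxCount_mem (η n N) s)
    (a := N * p n N) ⟨mul_nonneg hN0.le hp01.1, mul_le_of_le_one_right hN0.le hp01.2⟩
    (zero_le_one.trans hr1)
  have hsmall : (N : ℝ) * (2 / (N : ℝ) ^ (K + 2)) ≤ 1 := by
    have hpow : (1 : ℝ) ≤ (N : ℝ) ^ K := one_le_pow₀ (by linarith)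
    rw [mul_div_assoc', div_le_one (by positivity), pow_add]
    nlinarith [mul_le_mul_of_nonneg_right hpow (show (0 : ℝ) ≤ (N : ℝ) ^ 2 by positivity)]
  have hmean' : |∫ ω', X ω' ∂P - N * p n N| ≤ 2 * r := by
    refine hmean.trans ?_
    have := mul_le_mul_of_nonneg_left hpP hN0.le
    linarith
  have hdev : |X ω - ∫ ω', X ω' ∂P| ≤ 3 * r := by
    have := hxω n hx
    have h3 := abs_sub_le (X ω) (N * p n N) (∫ ω', X ω' ∂P)
    rw [abs_sub_comm (N * p n N)] at h3
    linarith
  rw [Real.norm_eq_abs, abs_div, abs_div, abs_of_nonneg (Real.sqrt_nonneg _), mul_div_assoc']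
  refine div_le_div_of_nonneg_right (hdev.trans (le_of_eq ?_)) (abs_nonneg _)
  rw [hr]
  ring
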